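/- Let $q\in\mathbb R$, $q\neq 0$. Repeated indices are summed. Capital indices run through $1,2$; small indices are double indices $a=(A,A')$ running through $(11),(12),(21),(22)$, also numbered $1,2,3,4$. **R-matrices and q-Minkowski space.** Let $R$ be the $4\times4$ matrix with rows and columns labelled by $(11),(12),(21),(22)$ and non-zero entries $R^{11}_{11}=R^{22}_{22}=q$, $R^{12}_{12}=R^{21}_{21}=1$, $R^{12}_{21}=q-q^{-1}$, let $\widetilde R=((R^{t_2})^{-1})^{t_2}$ ($t_2$ = transposition in the second tensor factor), and $$R^{\ \ ab}_{M\,cd}=(R^{-1})^{LC}_{BI}R^{B'I}_{JA}R^{A'J}_{KD'}\widetilde R^{KD}_{C'L},\qquad R^{\ \ ab}_{L\,cd}=R^{CI}_{JB}R^{B'J}_{KA}R^{A'K}_{LD'}\widetilde R^{LD}_{C'I}.$$ q-Minkowski space $M_q$ is the unital $\mathbb C$-algebra with generators $x_1,\dots,x_4$ and relations $x_ax_b=x_cx_d\,R^{\ \ dc}_{M\,ab}$. **Derivatives and metric.** The braided differential operators $\partial^a:M_q\to M_q$ are the linear maps with $\partial^a1=0$, $\partial^ax_b=\delta^a_b$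 and the braided Leibniz rule $\partial^a(fg)=(\partial^af)g+\Lambda^a{}_d(f)\,\partial^dg$, where $\Lambda^a{}_d:M_q\to M_q$ are the linear maps with $\Lambda^a{}_d(1)=\delta^a_d$, $\Lambda^a{}_d(x_b)=x_c\,R^{\ \ ca}_{L\,bd}$, $\Lambda^a{}_d(fg)=\Lambda^a{}_e(f)\Lambda^e{}_d(g)$. Let $(\varepsilon_{AB})=\begin{pmatrix}0&q^{-1/2}\\-q^{1/2}&0\end{pmatrix}$, let $\varepsilon^{AB}$ be given by $\varepsilon_{AB}\varepsilon^{CB}=\delta_A^C$, and $$g^{ab}=\frac1{q+q^{-1}}\,\varepsilon_{AC}R^{A'C}_{DB}\varepsilon^{DB'},\qquad g_{ak}g^{ai}=\delta^i_k,\qquad \hat g^{ab}=(q+q^{-1})g^{ab},\qquad \partial_a=g_{ab}\partial^b .$$ **Antisymmetrisers.** Let $\varepsilon_{abcd}$ be the complex tensor, unique with $\varepsilon_{1234}=1$, that is totally q-antisymmetric: $\varepsilon_{abcd}=-\varepsilon_{ijcd}R^{\ \ ji}_{L\,ab}=-\varepsilon_{aijd}R^{\ \ ji}_{L\,bc}=-\varepsilon_{abij}R^{\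 \ ji}_{L\,cd}$. Put $\varepsilon^{abcd}=\varepsilon_{ijkl}\hat g^{ia}\hat g^{jb}\hat g^{kc}\hat g^{ld}$, $n_1=n_3=2(1+q^2+q^4)$, $n_2=(1+q^2)^2$, $n_0=n_4=2q^{-2}(1+q^2+q^4)(1+q^2)^2$. The q-antisymmetrisers are $$\mathcal A^{\ \ abcd}_{\{4\}efgh}=\tfrac1{n_4}\varepsilon^{dcba}\varepsilon_{efgh},\quad \mathcal A^{\ \ abc}_{\{3\}fgh}=-\tfrac1{n_3}\varepsilon^{dcba}\varepsilon_{dfgh},\quad \mathcal A^{\ \ ab}_{\{2\}gh}=\tfrac1{n_2}\varepsilon^{dcba}\varepsilon_{cdgh},\quad \mathcal A^{\ \ a}_{\{1\}h}=-\tfrac1{n_1}\varepsilon^{dcba}\varepsilon_{bcdh},$$ with $\mathcal A_{\{0\}}=1$ and $\mathcal A_{\{n\}}=0$ for $n>4$; write $T_{[a_1\dots a_n]}=T_{c_1\dots c_n}\mathcal A^{\ \ c_1\dots c_n}_{\{n\}a_1\dots a_n}$. **Forms.** Let $V$ be the complex vector space with basis $dx_1,\dots,dx_4$, let $\mathbf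 e_{a_1\dots a_p}=dx_{[a_1}\otimes\dots\otimes dx_{a_p]}\in V^{\otimes p}$ (for $p=0$: $\mathbf e=1\in\mathbb C$), and let $\Lambda_p$ be the span of these elements. A $p$-form is a linear map $\mathbf w:\Lambda_p\to M_q$, with components $w_{[a_1\dots a_p]}=\mathbf w(\mathbf e_{a_1\dots a_p})$ (for a 0-form $\boldsymbol\varphi$: $\varphi=\boldsymbol\varphi(\mathbf e)\in M_q$, which is arbitrary). $\Omega_p$ is the space of $p$-forms, so $\Omega_p=0$ for $p>4$; also $\Omega_{-1}=0$. Define $$d:\Omega_p\to\Omega_{p+1},\qquad d\mathbf w(\mathbf e_{a_1\dots a_{p+1}})=\partial_{[a_1}w_{a_2\dots a_{p+1}]},$$ $${}^*:\Omega_p\to\Omega_{4-p},\qquad {}^*\mathbf w(\mathbf e_{a_1\dots a_{4-p}})=n_p^{-1/2}\,\varepsilon_{a_1\dots a_{4-p}b_1\dots b_p}\,\hat g^{b_1c_p}\cdots\hat g^{b_pc_1}\,w_{[c_1\dots c_p]},$$ $$\delta={}^*d\,{}^*,\qquad \Delta=\delta d+d\delta .$$ **Proposition.** For every 0-form $\boldsymbol\varphi$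 on q-Minkowski space, with value $\varphi=\boldsymbol\varphi(\mathbf e)\in M_q$, the q-d'Alembert equation $\Delta\boldsymbol\varphi=0$ holds if and only if $\Box\varphi=0$, where $\Box=\partial_a\partial_b\,g^{ab}$ is the q-d'Alembert operator. -/

import Mathlib

open scoped BigOperators Matrix

namespace QMinkowski

noncomputable section

/-- The multi-index `a = (A A')` runs through `(11), (12), (21), (22)`. -/
def spin : Fin 4 → Fin 2 × Fin 2 := ![(0, 0), (0, 1), (1, 0), (1, 1)]

/-- The `SU_q(2)` R-matrix; the entry in row `(a, b)` and column `(c, d)` is `R^{ab}_{cd}`. -/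
def rMat (q : ℝ) : Matrix (Fin 2 × Fin 2) (Fin 2 × Fin 2) ℂ :=
  Matrix.submatrix
    (!![(q : ℂ), 0, 0, 0;
        0, 1, (q : ℂ) - (q : ℂ)⁻¹, 0;
        0, 0, 1, 0;
        0, 0, 0, (q : ℂ)] : Matrix (Fin 4) (Fin 4) ℂ)
    finProdFinEquiv finProdFinEquiv

/-- Transposition in the second tensor component. -/
def transposeSnd (M : Matrix (Fin 2 × Fin 2) (Fin 2 × Fin 2) ℂ) :
    Matrix (Fin 2 × Fin 2) (Fin 2 × Fin 2) ℂ :=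
  Matrix.of fun i j => M (i.1, j.2) (j.1, i.2)

/-- `R̃ = ((R^{t₂})⁻¹)^{t₂}`. -/
def rTilde (q : ℝ) : Matrix (Fin 2 × Fin 2) (Fin 2 × Fin 2) ℂ :=
  transposeSnd (transposeSnd (rMat q))⁻¹

/-- `R_M^{ab}_{cd} = (R⁻¹)^{LC}_{BI} R^{B'I}_{JA} R^{A'J}_{KD'} R̃^{KD}_{C'L}`. -/
def rM (q : ℝ) (a b c d : Fin 4) : ℂ :=
  ∑ I : Fin 2, ∑ J : Fin 2, ∑ K : Fin 2, ∑ L : Fin 2,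
    (rMat q)⁻¹ (L, (spin c).1) ((spin b).1, I) * rMat q ((spin b).2, I) (J, (spin a).1) *
      rMat q ((spin a).2, J) (K, (spin d).2) * rTilde q (K, (spin d).1) ((spin c).2, L)

/-- `R_L^{ab}_{cd} = R^{CI}_{JB} R^{B'J}_{KA} R^{A'K}_{LD'} R̃^{LD}_{C'I}`. -/
def rL (q : ℝ) (a b c d : Fin 4) : ℂ :=
  ∑ I : Fin 2, ∑ J : Fin 2, ∑ K : Fin 2, ∑ L : Fin 2,
    rMat q ((spin c).1, I) (J, (spin b).1) * rMat q ((spin b).2, J) (K, (spin a).1) *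
      rMat q ((spin a).2, K) (L, (spin d).2) * rTilde q (L, (spin d).1) ((spin c).2, I)

/-- The relations `x_a x_b = x_c x_d R_M^{dc}_{ab}` of quantum covectors. -/
inductive Rel (q : ℝ) : FreeAlgebra ℂ (Fin 4) → FreeAlgebra ℂ (Fin 4) → Prop
  | comm (a b : Fin 4) : Rel q (FreeAlgebra.ι ℂ a * FreeAlgebra.ι ℂ b)
      (∑ c, ∑ d, rM q d c a b • (FreeAlgebra.ι ℂ c * FreeAlgebra.ι ℂ d))

/-- q-Minkowski space `M_q = V'(R_M)`. -/
abbrev Mq (q : ℝ) : Type := RingQuot (Rel q)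

/-- The generators `x_a` of `M_q`. -/
def x (q : ℝ) (a : Fin 4) : Mq q := RingQuot.mkAlgHom ℂ (Rel q) (FreeAlgebra.ι ℂ a)

theorem x_mul_x (q : ℝ) (a b : Fin 4) :
    x q a * x q b = ∑ c, ∑ d, rM q d c a b • (x q c * x q d) := by
  have h := RingQuot.mkAlgHom_rel ℂ (Rel.comm (q := q) a b)
  simpa [x, map_sum, map_mul, map_smul] using h

theorem rMat_inv (q : ℝ) (hq : q ≠ 0) : (rMat q)⁻¹ = Matrix.submatrix
    (!![(q : ℂ)⁻¹, 0, 0, 0;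
        0, 1, (q : ℂ)⁻¹ - (q : ℂ), 0;
        0, 0, 1, 0;
        0, 0, 0, (q : ℂ)⁻¹] : Matrix (Fin 4) (Fin 4) ℂ)
    finProdFinEquiv finProdFinEquiv := by
  have h : (q : ℂ) ≠ 0 := by exact_mod_cast hq
  apply Matrix.inv_eq_right_inv
  ext ⟨i, j⟩ ⟨k, l⟩
  fin_cases i <;> fin_cases j <;> fin_cases k <;> fin_cases l <;>
    simp [rMat, Matrix.mul_apply, Fintype.sum_prod_type, Fin.sum_univ_two, finProdFinEquiv, h]

theorem rTilde_eq (q : ℝ) (hq : q ≠ 0) : rTilde q = Matrix.submatrix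
    (!![(q : ℂ)⁻¹, 0, 0, 0;
        0, 1, (q : ℂ)⁻¹ ^ 3 - (q : ℂ)⁻¹, 0;
        0, 0, 1, 0;
        0, 0, 0, (q : ℂ)⁻¹] : Matrix (Fin 4) (Fin 4) ℂ)
    finProdFinEquiv finProdFinEquiv := by
  have h : (q : ℂ) ≠ 0 := by exact_mod_cast hq
  have hinv : (transposeSnd (rMat q))⁻¹ = transposeSnd (Matrix.submatrix
    (!![(q : ℂ)⁻¹, 0, 0, 0;
        0, 1, (q : ℂ)⁻¹ ^ 3 - (q : ℂ)⁻¹, 0;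
        0, 0, 1, 0;
        0, 0, 0, (q : ℂ)⁻¹] : Matrix (Fin 4) (Fin 4) ℂ)
    finProdFinEquiv finProdFinEquiv) := by
    apply Matrix.inv_eq_right_inv
    ext ⟨i, j⟩ ⟨k, l⟩
    fin_cases i <;> fin_cases j <;> fin_cases k <;> fin_cases l <;>
      simp [rMat, transposeSnd, Matrix.mul_apply, Fintype.sum_prod_type, Fin.sum_univ_two,
        finProdFinEquiv, h]
    field_simp
    ring
  rw [rTilde, hinv]
  rfl

/-! Polynomials with integer coefficients as coefficient lists, to check the Yang–Baxter type
identities that make the braided derivatives well defined on the quotient `M_q`. -/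

/-- Sum of coefficient lists. -/
def padd : List ℤ → List ℤ → List ℤ
  | [], l => l
  | a :: l, [] => a :: l
  | a :: l, b :: m => (a + b) :: padd l m

/-- Product of coefficient lists. -/
def pmul : List ℤ → List ℤ → List ℤ
  | [], _ => []
  | _ :: _, [] => []
  | a :: l, b :: m => padd ((b :: m).map (a * ·)) (0 :: pmul l (b :: m))

def psum2 (f : Fin 2 → List ℤ) : List ℤ := padd (f 0) (f 1)

def psum4 (f : Fin 4 → List ℤ) : List ℤ := padd (f 0) (padd (f 1) (padd (f 2) (f 3)))

/-- `l = m` up to trailing zeros. -/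
def peq (l m : List ℤ) : Bool := (padd l (m.map (-1 * ·))).all (· == 0)

/-- Substitution of the square of the variable. -/
def pexpand : List ℤ → List ℤ
  | [] => []
  | a :: l => a :: 0 :: pexpand l

/-- Value of a coefficient list at `t`. -/
def pev (t : ℂ) : List ℤ → ℂ
  | [] => 0
  | a :: l => a + t * pev t l

theorem pev_padd (t : ℂ) (l m : List ℤ) : pev t (padd l m) = pev t l + pev t m := by
  induction l generalizing m with
  | nil => simp [padd, pev]
  | cons a l ih =>
    cases m with
    | nil => simp [padd, pev]
    | cons b m => simp [padd, pev, ih]; ring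

theorem pev_map (t : ℂ) (a : ℤ) (l : List ℤ) : pev t (l.map (a * ·)) = a * pev t l := by
  induction l with
  | nil => simp [pev]
  | cons b l ih => simp only [List.map_cons, pev, ih]; push_cast; ring

theorem pev_pmul (t : ℂ) (l m : List ℤ) : pev t (pmul l m) = pev t l * pev t m := by
  induction l with
  | nil => simp [pmul, pev]
  | cons a l ih =>
    cases m with
    | nil => simp [pmul, pev]
    | cons b m =>
      rw [pmul, pev_padd, pev_map]
      simp only [pev] at ih ⊢
      rw [ih]; push_cast; ring

theorem pev_psum2 (t : ℂ) (f : Fin 2 → List ℤ) : pev t (psum2 f) = ∑ i, pev t (f i) := by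
  simp [psum2, pev_padd, Fin.sum_univ_two]

theorem pev_psum4 (t : ℂ) (f : Fin 4 → List ℤ) : pev t (psum4 f) = ∑ i, pev t (f i) := by
  simp [psum4, pev_padd, Fin.sum_univ_four, add_assoc]

theorem pev_zero (t : ℂ) (l : List ℤ) (h : l.all (· == 0) = true) : pev t l = 0 := by
  induction l with
  | nil => rfl
  | cons a l ih =>
    simp only [List.all_cons, Bool.and_eq_true, beq_iff_eq] at h
    simp [pev, h.1, ih h.2]

theorem pev_peq (t : ℂ) (l m : List ℤ) (h : peq l m = true) : pev t l = pev t m := by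
  have := pev_zero t _ h
  rw [pev_padd, pev_map] at this
  push_cast at this
  linear_combination this

theorem pev_pexpand (t : ℂ) (l : List ℤ) : pev t (pexpand l) = pev (t ^ 2) l := by
  induction l with
  | nil => rfl
  | cons a l ih => simp [pexpand, pev, ih]; ring

/-- `q R`, and below `q R⁻¹` and `q^3 R̃`, as polynomials in `q`. -/
def polR : Fin 2 × Fin 2 → Fin 2 × Fin 2 → List ℤ
  | (0, 0), (0, 0) => [0, 0, 1] | (1, 1), (1, 1) => [0, 0, 1]
  | (0, 1), (0, 1) => [0, 1] | (1, 0), (1, 0) => [0, 1]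
  | (0, 1), (1, 0) => [-1, 0, 1]
  | _, _ => []

def polRinv : Fin 2 × Fin 2 → Fin 2 × Fin 2 → List ℤ
  | (0, 0), (0, 0) => [1] | (1, 1), (1, 1) => [1]
  | (0, 1), (0, 1) => [0, 1] | (1, 0), (1, 0) => [0, 1]
  | (0, 1), (1, 0) => [1, 0, -1]
  | _, _ => []

def polRtilde : Fin 2 × Fin 2 → Fin 2 × Fin 2 → List ℤ
  | (0, 0), (0, 0) => [0, 0, 1] | (1, 1), (1, 1) => [0, 0, 1]
  | (0, 1), (0, 1) => [0, 0, 0, 1] | (1, 0), (1, 0) => [0, 0, 0, 1]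
  | (0, 1), (1, 0) => [1, 0, -1]
  | _, _ => []

theorem pev_polR (q : ℝ) (hq : q ≠ 0) (i j : Fin 2 × Fin 2) :
    pev q (polR i j) = q * rMat q i j := by
  have h : (q : ℂ) ≠ 0 := by exact_mod_cast hq
  obtain ⟨a, b⟩ := i
  obtain ⟨c, d⟩ := j
  fin_cases a <;> fin_cases b <;> fin_cases c <;> fin_cases d <;>
    simp [polR, pev, rMat, finProdFinEquiv] <;> field_simp <;> ring

theorem pev_polRinv (q : ℝ) (hq : q ≠ 0) (i j : Fin 2 × Fin 2) :
    pev q (polRinv i j) = q * (rMat q)⁻¹ i j := by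
  have h : (q : ℂ) ≠ 0 := by exact_mod_cast hq
  rw [rMat_inv q hq]
  obtain ⟨a, b⟩ := i
  obtain ⟨c, d⟩ := j
  fin_cases a <;> fin_cases b <;> fin_cases c <;> fin_cases d <;>
    simp [polRinv, pev, finProdFinEquiv, h] <;> field_simp <;> ring

theorem pev_polRtilde (q : ℝ) (hq : q ≠ 0) (i j : Fin 2 × Fin 2) :
    pev q (polRtilde i j) = q ^ 3 * rTilde q i j := by
  have h : (q : ℂ) ≠ 0 := by exact_mod_cast hq
  rw [rTilde_eq q hq]
  obtain ⟨a, b⟩ := i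
  obtain ⟨c, d⟩ := j
  fin_cases a <;> fin_cases b <;> fin_cases c <;> fin_cases d <;>
    simp [polRtilde, pev, finProdFinEquiv] <;> field_simp <;> ring

/-- `q^4 R_M` as polynomials in `q^2`. -/
def tabM : Fin 4 → Fin 4 → Fin 4 → Fin 4 → List ℤ
  | 0, 0, 0, 0 => [0, 0, 1] | 0, 0, 1, 2 => [0, 1, -1] | 0, 0, 2, 1 => [0, -1, 1]
  | 0, 0, 3, 0 => [0, 1, -2, 1] | 0, 0, 3, 3 => [-1, 2, -1] | 0, 1, 0, 1 => [0, 1]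
  | 0, 1, 1, 0 => [0, -1, 1] | 0, 1, 1, 3 => [1, -1] | 0, 2, 0, 2 => [0, 0, 0, 1]
  | 0, 2, 2, 0 => [0, 0, 1, -1] | 0, 2, 2, 3 => [0, -1, 1] | 0, 2, 3, 2 => [1, -1, -1, 1]
  | 0, 3, 0, 3 => [0, 0, 1] | 0, 3, 1, 2 => [0, -1, 1] | 0, 3, 2, 1 => [0, 1, -1]
  | 0, 3, 3, 0 => [0, -1, 2, -1] | 0, 3, 3, 3 => [1, -2, 1] | 1, 0, 1, 0 => [0, 0, 1]
  | 1, 0, 3, 1 => [0, 0, -1, 1] | 1, 1, 1, 1 => [0, 0, 1] | 1, 2, 1, 2 => [0, 0, 1]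
  | 1, 2, 3, 0 => [0, 0, 1, -1] | 1, 2, 3, 3 => [0, -1, 1] | 1, 3, 1, 3 => [0, 0, 1]
  | 1, 3, 3, 1 => [0, 0, 1, -1] | 2, 0, 2, 0 => [0, 0, 1] | 2, 0, 3, 2 => [0, 1, -1]
  | 2, 1, 2, 1 => [0, 0, 1] | 2, 1, 3, 0 => [0, 0, -1, 1] | 2, 1, 3, 3 => [0, 1, -1]
  | 2, 2, 2, 2 => [0, 0, 1] | 2, 3, 2, 3 => [0, 0, 1] | 2, 3, 3, 2 => [0, -1, 1]
  | 3, 0, 3, 0 => [0, 0, 1] | 3, 1, 3, 1 => [0, 0, 0, 1] | 3, 2, 3, 2 => [0, 1]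
  | 3, 3, 3, 3 => [0, 0, 1]
  | _, _, _, _ => []

/-- `q^4 R_L` as polynomials in `q^2`. -/
def tabL : Fin 4 → Fin 4 → Fin 4 → Fin 4 → List ℤ
  | 0, 0, 0, 0 => [0, 0, 0, 1] | 0, 0, 0, 3 => [0, 1, -2, 1] | 0, 0, 1, 2 => [-1, 3, -2]
  | 0, 0, 2, 1 => [0, -1, 1] | 0, 0, 3, 0 => [0, 1, -2, 1] | 0, 0, 3, 3 => [-1, 2, -1]
  | 0, 1, 0, 1 => [0, 0, 1] | 0, 1, 1, 0 => [0, 0, -1, 1] | 0, 1, 1, 3 => [0, 1, -1]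
  | 0, 2, 0, 2 => [0, 0, 0, 1] | 0, 2, 2, 3 => [0, 0, -1, 1] | 0, 2, 3, 2 => [0, 1, -2, 1]
  | 0, 3, 0, 3 => [0, 0, 1] | 0, 3, 1, 2 => [0, -1, 1] | 1, 0, 1, 0 => [0, 0, 0, 1]
  | 1, 0, 1, 3 => [0, 1, -2, 1] | 1, 0, 3, 1 => [0, 0, -1, 1] | 1, 1, 1, 1 => [0, 0, 0, 1]
  | 1, 2, 1, 2 => [0, 0, 1] | 1, 2, 3, 3 => [0, 0, -1, 1] | 1, 3, 1, 3 => [0, 0, 1]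
  | 2, 0, 0, 2 => [0, 0, -1, 1] | 2, 0, 2, 0 => [0, 0, 1] | 2, 0, 3, 2 => [0, 1, -1]
  | 2, 1, 0, 3 => [0, 0, -1, 1] | 2, 1, 1, 2 => [0, 1, -2, 1] | 2, 1, 2, 1 => [0, 0, 1]
  | 2, 1, 3, 0 => [0, 0, -1, 1] | 2, 1, 3, 3 => [0, 1, -1] | 2, 2, 2, 2 => [0, 0, 0, 1]
  | 2, 3, 2, 3 => [0, 0, 0, 1] | 2, 3, 3, 2 => [0, 0, -1, 1] | 3, 0, 1, 2 => [0, -1, 1]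
  | 3, 0, 3, 0 => [0, 0, 1] | 3, 1, 1, 3 => [0, 0, -1, 1] | 3, 1, 3, 1 => [0, 0, 0, 1]
  | 3, 2, 3, 2 => [0, 0, 1] | 3, 3, 3, 3 => [0, 0, 0, 1]
  | _, _, _, _ => []

theorem tabM_spec : ∀ a b c d : Fin 4, peq (0 :: 0 :: pexpand (tabM a b c d))
    (psum2 fun I => psum2 fun J => psum2 fun K => psum2 fun L =>
      pmul (pmul (pmul (polRinv (L, (spin c).1) ((spin b).1, I))
        (polR ((spin b).2, I) (J, (spin a).1))) (polR ((spin a).2, J) (K, (spin d).2)))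
        (polRtilde (K, (spin d).1) ((spin c).2, L))) = true := by
  decide +kernel

theorem tabL_spec : ∀ a b c d : Fin 4, peq (0 :: 0 :: pexpand (tabL a b c d))
    (psum2 fun I => psum2 fun J => psum2 fun K => psum2 fun L =>
      pmul (pmul (pmul (polR ((spin c).1, I) (J, (spin b).1))
        (polR ((spin b).2, J) (K, (spin a).1))) (polR ((spin a).2, K) (L, (spin d).2)))
        (polRtilde (L, (spin d).1) ((spin c).2, I))) = true := by
  decide +kernel

theorem tab_hecke : ∀ c a i j : Fin 4, peq
    (padd (pmul [0, 0, 1] (tabL c a i j)) (if a = i ∧ c = j then [0, 0, 0, 0, 1] else []))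
    (padd (psum4 fun k => psum4 fun l => pmul (tabM l k i j) (tabL c a k l))
      (pmul [0, 0, 1] (tabM c a i j))) = true := by
  decide +kernel

theorem tab_ybe : ∀ m n a b i j : Fin 4, peq
    (psum4 fun c => psum4 fun d =>
      pmul (tabM n m c d) (psum4 fun e => pmul (tabL c a i e) (tabL d e j b)))
    (psum4 fun k => psum4 fun l =>
      pmul (tabM l k i j) (psum4 fun e => pmul (tabL m a k e) (tabL n e l b))) = true := by
  decide +kernel

theorem pev_tabM (q : ℝ) (hq : q ≠ 0) (a b c d : Fin 4) :
    pev (q ^ 2) (tabM a b c d) = q ^ 4 * rM q a b c d := by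
  have h : (q : ℂ) ≠ 0 := by exact_mod_cast hq
  have := pev_peq q _ _ (tabM_spec a b c d)
  simp only [pev, pev_pexpand, pev_psum2, pev_pmul, pev_polR q hq, pev_polRinv q hq,
    pev_polRtilde q hq] at this
  have h2 : (q : ℂ) ^ 2 * pev (q ^ 2) (tabM a b c d) = q ^ 2 * (q ^ 4 * rM q a b c d) := by
    rw [rM]
    simp only [Finset.mul_sum]
    refine Eq.trans ?_ (this.trans ?_)
    · push_cast; ring
    · refine Finset.sum_congr rfl fun I _ => Finset.sum_congr rfl fun J _ =>
        Finset.sum_congr rfl fun K _ => Finset.sum_congr rfl fun L _ => ?_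
      ring
  exact mul_left_cancel₀ (pow_ne_zero 2 h) h2

theorem pev_tabL (q : ℝ) (hq : q ≠ 0) (a b c d : Fin 4) :
    pev (q ^ 2) (tabL a b c d) = q ^ 4 * rL q a b c d := by
  have h : (q : ℂ) ≠ 0 := by exact_mod_cast hq
  have := pev_peq q _ _ (tabL_spec a b c d)
  simp only [pev, pev_pexpand, pev_psum2, pev_pmul, pev_polR q hq, pev_polRtilde q hq] at this
  have h2 : (q : ℂ) ^ 2 * pev (q ^ 2) (tabL a b c d) = q ^ 2 * (q ^ 4 * rL q a b c d) := by
    rw [rL]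
    simp only [Finset.mul_sum]
    refine Eq.trans ?_ (this.trans ?_)
    · push_cast; ring
    · refine Finset.sum_congr rfl fun I _ => Finset.sum_congr rfl fun J _ =>
        Finset.sum_congr rfl fun K _ => Finset.sum_congr rfl fun L _ => ?_
      ring
  exact mul_left_cancel₀ (pow_ne_zero 2 h) h2

/-- `(P R_L + 1)(P R_M - 1) = 0` in components. -/
theorem hecke (q : ℝ) (hq : q ≠ 0) (c a i j : Fin 4) :
    rL q c a i j + (if a = i ∧ c = j then 1 else 0) =
      (∑ k, ∑ l, rM q l k i j * rL q c a k l) + rM q c a i j := by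
  have h : (q : ℂ) ≠ 0 := by exact_mod_cast hq
  have := pev_peq ((q : ℂ) ^ 2) _ _ (tab_hecke c a i j)
  simp only [pev_padd, pev_psum4, pev_pmul, pev_tabM q hq, pev_tabL q hq,
    apply_ite (pev ((q : ℂ) ^ 2)), pev] at this
  apply mul_left_cancel₀ (pow_ne_zero 8 h)
  rw [mul_add, mul_add, Finset.mul_sum]
  simp only [Finset.mul_sum]
  refine Eq.trans ?_ (this.trans ?_)
  · split_ifs <;> push_cast <;> ring
  · congr 1
    · refine Finset.sum_congr rfl fun k _ => Finset.sum_congr rfl fun l _ => ?_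
      ring
    · push_cast; ring

/-- The mixed Yang-Baxter equation for `R_M` and `R_L` in components. -/
theorem ybe (q : ℝ) (hq : q ≠ 0) (m n a b i j : Fin 4) :
    ∑ c, ∑ d, rM q n m c d * ∑ e, rL q c a i e * rL q d e j b =
      ∑ k, ∑ l, rM q l k i j * ∑ e, rL q m a k e * rL q n e l b := by
  have h : (q : ℂ) ≠ 0 := by exact_mod_cast hq
  have := pev_peq ((q : ℂ) ^ 2) _ _ (tab_ybe m n a b i j)
  simp only [pev_psum4, pev_pmul, pev_tabM q hq, pev_tabL q hq] at this
  apply mul_left_cancel₀ (pow_ne_zero 12 h)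
  simp only [Finset.mul_sum] at this ⊢
  refine Eq.trans ?_ (this.trans ?_)
  all_goals
    refine Finset.sum_congr rfl fun k _ => Finset.sum_congr rfl fun l _ =>
      Finset.sum_congr rfl fun e _ => ?_
    ring

/-- The algebra homomorphism from `M_q` to block triangular matrices
`f ↦ ((L(f), ∂f), (0, f))`, where `L` implements the inverse braiding
`Ψ⁻¹(∂^a ⊗ x_b) = x_c ⊗ ∂^d R_L^{ca}_{bd}`; on generators `∂^a x_b = δ^a_b`.
Multiplicativity of the last column is the braided Leibniz rule. -/
def leibnizGen (q : ℝ) (b : Fin 4) : Matrix (Option (Fin 4)) (Option (Fin 4)) (Mq q) :=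
  Matrix.of fun
    | some a, some d => ∑ c, rL q c a b d • x q c
    | some a, none => if a = b then 1 else 0
    | none, some _ => 0
    | none, none => x q b

theorem leibnizGen_rel (q : ℝ) (hq : q ≠ 0) (i j : Fin 4) :
    leibnizGen q i * leibnizGen q j =
      ∑ k, ∑ l, rM q l k i j • (leibnizGen q k * leibnizGen q l) := by
  ext (_ | a) (_ | b)
  · simp only [Matrix.sum_apply, Matrix.smul_apply, Matrix.mul_apply, Fintype.sum_option]
    simpa [leibnizGen] using x_mul_x q i j
  · simp [Matrix.sum_apply, Matrix.mul_apply, Fintype.sum_option, leibnizGen]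
  · simp only [Matrix.sum_apply, Matrix.smul_apply, Matrix.mul_apply, Fintype.sum_option]
    simp only [leibnizGen, Matrix.of_apply, mul_ite, mul_one, mul_zero, Finset.sum_ite_eq',
      Finset.mem_univ, if_true, ite_mul, one_mul, zero_mul]
    have h1 : ∀ k l : Fin 4, (if a = k then x q l else 0) + ∑ c, rL q c a k l • x q c =
        ∑ c, (rL q c a k l + if a = k ∧ c = l then 1 else 0) • x q c := by
      intro k l
      by_cases hk : a = k <;> simp [hk, add_smul, Finset.sum_add_distrib, ite_smul, add_comm]
    simp only [h1, Finset.smul_sum, smul_smul]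
    rw [Finset.sum_congr rfl fun k _ => Finset.sum_comm, Finset.sum_comm]
    refine Finset.sum_congr rfl fun c _ => ?_
    simp only [← Finset.sum_smul]
    congr 1
    rw [hecke q hq c a i j]
    simp only [mul_add, Finset.sum_add_distrib]
    congr 1
    rw [Finset.sum_eq_single a, Finset.sum_eq_single c] <;> simp +contextual [eq_comm]
  · simp only [Matrix.sum_apply, Matrix.smul_apply, Matrix.mul_apply, Fintype.sum_option]
    simp only [leibnizGen, Matrix.of_apply, mul_zero, zero_add]
    have h1 : ∀ k l : Fin 4,
        (∑ e, (∑ c, rL q c a k e • x q c) * ∑ d, rL q d e l b • x q d) =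
          ∑ c, ∑ d, (∑ e, rL q c a k e * rL q d e l b) • (x q c * x q d) := by
      intro k l
      simp only [Finset.sum_mul_sum, smul_mul_smul_comm, Finset.sum_smul]
      rw [Finset.sum_comm]
      refine Finset.sum_congr rfl fun c _ => ?_
      rw [Finset.sum_comm]
    simp only [h1]
    have h2 : ∀ c d : Fin 4, (∑ e, rL q c a i e * rL q d e j b) • (x q c * x q d) =
        ∑ m, ∑ n, (rM q n m c d * ∑ e, rL q c a i e * rL q d e j b) • (x q m * x q n) := by
      intro c d
      rw [x_mul_x q c d]
      simp only [Finset.smul_sum, smul_smul]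
      refine Finset.sum_congr rfl fun m _ => Finset.sum_congr rfl fun n _ => ?_
      rw [mul_comm]
    simp only [h2, Finset.smul_sum, smul_smul]
    have swap : ∀ F : Fin 4 → Fin 4 → Fin 4 → Fin 4 → Mq q,
        ∑ c, ∑ d, ∑ m, ∑ n, F c d m n = ∑ m, ∑ n, ∑ c, ∑ d, F c d m n := by
      intro F
      calc ∑ c, ∑ d, ∑ m, ∑ n, F c d m n = ∑ c, ∑ m, ∑ d, ∑ n, F c d m n :=
            Finset.sum_congr rfl fun c _ => Finset.sum_comm
        _ = ∑ m, ∑ c, ∑ d, ∑ n, F c d m n := Finset.sum_comm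
        _ = ∑ m, ∑ c, ∑ n, ∑ d, F c d m n :=
            Finset.sum_congr rfl fun m _ => Finset.sum_congr rfl fun c _ => Finset.sum_comm
        _ = _ := Finset.sum_congr rfl fun m _ => Finset.sum_comm
    refine (swap _).trans (Eq.trans ?_ (swap _).symm)
    refine Finset.sum_congr rfl fun m _ => Finset.sum_congr rfl fun n _ => ?_
    simp only [← Finset.sum_smul]
    rw [ybe q hq m n a b i j]

def leibnizHom (q : ℝ) (hq : q ≠ 0) :
    Mq q →ₐ[ℂ] Matrix (Option (Fin 4)) (Option (Fin 4)) (Mq q) :=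
  RingQuot.liftAlgHom ℂ ⟨FreeAlgebra.lift ℂ (leibnizGen q), by
    rintro _ _ ⟨a, b⟩
    simpa [map_sum, map_mul, map_smul] using leibnizGen_rel q hq a b⟩

theorem leibnizHom_x (q : ℝ) (hq : q ≠ 0) (b : Fin 4) :
    leibnizHom q hq (x q b) = leibnizGen q b := by
  simp [leibnizHom, x]

/-- The braided differential operator `∂^a` on `M_q`. -/
def partialUp (q : ℝ) (hq : q ≠ 0) (a : Fin 4) : Mq q →ₗ[ℂ] Mq q where
  toFun f := leibnizHom q hq f (some a) none
  map_add' f g := by simp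
  map_smul' r f := by simp

/-- The action on `M_q` by which `∂^d` is carried past an element:
`Ψ⁻¹(∂^a ⊗ f) = Σ_d carry a d f ⊗ ∂^d`. -/
def carry (q : ℝ) (hq : q ≠ 0) (a d : Fin 4) : Mq q →ₗ[ℂ] Mq q where
  toFun f := leibnizHom q hq f (some a) (some d)
  map_add' f g := by simp
  map_smul' r f := by simp

theorem leibnizHom_corner (q : ℝ) (hq : q ≠ 0) (f : Mq q) :
    leibnizHom q hq f none none = f ∧ ∀ a, leibnizHom q hq f none (some a) = 0 := by
  obtain ⟨f, rfl⟩ := RingQuot.mkAlgHom_surjective ℂ (Rel q) f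
  induction f using FreeAlgebra.induction with
  | grade0 r => simp [AlgHom.commutes, Matrix.algebraMap_matrix_apply]
  | grade1 b =>
    have := leibnizHom_x q hq b
    rw [x] at this
    rw [this]
    simp [leibnizGen, x]
  | mul f g hf hg => simp [Matrix.mul_apply, Fintype.sum_option, hf, hg]
  | add f g hf hg => simp [hf, hg]

theorem partialUp_one (q : ℝ) (hq : q ≠ 0) (a : Fin 4) : partialUp q hq a 1 = 0 := by
  simp [partialUp]

theorem partialUp_x (q : ℝ) (hq : q ≠ 0) (a b : Fin 4) :
    partialUp q hq a (x q b) = if a = b then 1 else 0 := by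
  simp [partialUp, leibnizHom_x, leibnizGen]

theorem carry_x (q : ℝ) (hq : q ≠ 0) (a b d : Fin 4) :
    carry q hq a d (x q b) = ∑ c, rL q c a b d • x q c := by
  simp [carry, leibnizHom_x, leibnizGen]

theorem carry_mul (q : ℝ) (hq : q ≠ 0) (a d : Fin 4) (f g : Mq q) :
    carry q hq a d (f * g) = ∑ e, carry q hq a e f * carry q hq e d g := by
  simp [carry, Matrix.mul_apply, Fintype.sum_option, (leibnizHom_corner q hq g).2]

/-- The braided Leibniz rule. -/
theorem partialUp_mul (q : ℝ) (hq : q ≠ 0) (a : Fin 4) (f g : Mq q) :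
    partialUp q hq a (f * g) =
      partialUp q hq a f * g + ∑ d, carry q hq a d f * partialUp q hq d g := by
  simp [partialUp, carry, Matrix.mul_apply, Fintype.sum_option, (leibnizHom_corner q hq g).1]

/-- A square root of `q`. -/
def sqrtq (q : ℝ) : ℂ := (q : ℂ) ^ (1 / 2 : ℂ)

/-- The spinor metric `ε_{AB}`. -/
def spinorLow (q : ℝ) : Matrix (Fin 2) (Fin 2) ℂ := !![0, 1 / sqrtq q; -sqrtq q, 0]

/-- The spinor metric `ε^{AB}` with upper indices: `ε_{AB} ε^{CB} = δ_A^C`. -/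
def spinorUp (q : ℝ) : Matrix (Fin 2) (Fin 2) ℂ := ((spinorLow q)⁻¹)ᵀ

/-- The q-metric `g^{ab} = (q + q⁻¹)⁻¹ ε_{AC} R^{A'C}_{DB} ε^{DB'}`. -/
def metric (q : ℝ) : Matrix (Fin 4) (Fin 4) ℂ := Matrix.of fun a b =>
  1 / ((q : ℂ) + (q : ℂ)⁻¹) * ∑ C : Fin 2, ∑ D : Fin 2,
    spinorLow q (spin a).1 C * rMat q ((spin a).2, C) (D, (spin b).1) * spinorUp q D (spin b).2

/-- The inverse metric `g_{ab}`, with `g_{ak} g^{ai} = δ_k^i`. -/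
def metricLow (q : ℝ) : Matrix (Fin 4) (Fin 4) ℂ := ((metric q)⁻¹)ᵀ

/-- The metric `ĝ^{ab} = (q + q⁻¹) g^{ab}`. -/
def unitMetric (q : ℝ) : Matrix (Fin 4) (Fin 4) ℂ := ((q : ℂ) + (q : ℂ)⁻¹) • metric q

/-- `∂_a = g_{ab} ∂^b`, i.e. `∂^b = ∂_a g^{ab}`. -/
def partialLow (q : ℝ) (hq : q ≠ 0) (a : Fin 4) : Mq q →ₗ[ℂ] Mq q :=
  ∑ b, metricLow q a b • partialUp q hq b

/-- The q-d'Alembert operator `□ = ∂_a ∂_b g^{ab}`. -/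
def dAlembert (q : ℝ) (hq : q ≠ 0) : Mq q →ₗ[ℂ] Mq q :=
  ∑ a, ∑ b, metric q a b • (partialLow q hq a ∘ₗ partialLow q hq b)

/-- The totally q-antisymmetric tensor `ε_{abcd}` normalised by `ε_{1234} = 1`; the indices
`1, 2, 3, 4` are numbered `0, 1, 2, 3`. It is zero on lists of length different from four. -/
def epsLow (q : ℝ) : List (Fin 4) → ℂ
  | [0, 1, 2, 3] => 1 | [0, 1, 3, 2] => -(q : ℂ)⁻¹ ^ 2 | [0, 2, 1, 3] => -1
  | [0, 2, 3, 1] => (q : ℂ) ^ 2 | [0, 3, 0, 3] => 1 - (q : ℂ) ^ 2 | [0, 3, 1, 2] => 1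
  | [0, 3, 2, 1] => -1 | [0, 3, 3, 3] => 1 - (q : ℂ)⁻¹ ^ 2 | [1, 0, 2, 3] => -1
  | [1, 0, 3, 2] => (q : ℂ)⁻¹ ^ 2 | [1, 2, 0, 3] => 1 | [1, 2, 3, 0] => -1
  | [1, 3, 0, 2] => -(q : ℂ)⁻¹ ^ 2 | [1, 3, 2, 0] => (q : ℂ)⁻¹ ^ 2
  | [1, 3, 2, 3] => (q : ℂ)⁻¹ ^ 2 - 1 | [2, 0, 1, 3] => 1 | [2, 0, 3, 1] => -(q : ℂ) ^ 2
  | [2, 1, 0, 3] => -1 | [2, 1, 3, 0] => 1 | [2, 3, 0, 1] => (q : ℂ) ^ 2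
  | [2, 3, 1, 0] => -(q : ℂ) ^ 2 | [2, 3, 1, 3] => 1 - (q : ℂ) ^ 2 | [3, 0, 1, 2] => -1
  | [3, 0, 2, 1] => 1 | [3, 0, 3, 0] => (q : ℂ) ^ 2 - 1 | [3, 0, 3, 3] => (q : ℂ)⁻¹ ^ 2 - 1
  | [3, 1, 0, 2] => 1 | [3, 1, 2, 0] => -1 | [3, 1, 3, 2] => 1 - (q : ℂ)⁻¹ ^ 2
  | [3, 2, 0, 1] => -1 | [3, 2, 1, 0] => 1 | [3, 2, 3, 1] => (q : ℂ) ^ 2 - 1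
  | [3, 3, 0, 3] => 1 - (q : ℂ)⁻¹ ^ 2 | [3, 3, 3, 0] => (q : ℂ)⁻¹ ^ 2 - 1
  | _ => 0

/-- `ε^{abcd}`, obtained from `ε_{abcd}` by raising all indices with `ĝ`; it is zero on lists of
length different from four. -/
def epsUp (q : ℝ) : List (Fin 4) → ℂ
  | [a, b, c, d] => ∑ i, ∑ j, ∑ k, ∑ l, epsLow q [i, j, k, l] *
      unitMetric q i a * unitMetric q j b * unitMetric q k c * unitMetric q l d
  | _ => 0

/-- The normalisation factors `n_k`. -/
def normFactor (q : ℝ) : ℕ → ℝ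
  | 1 => 2 * (1 + q ^ 2 + q ^ 4)
  | 2 => (1 + q ^ 2) * (1 + q ^ 2)
  | 3 => 2 * (1 + q ^ 2 + q ^ 4)
  | _ => q⁻¹ ^ 2 * (2 * (1 + q ^ 2 + q ^ 4) * (1 + q ^ 2) * (1 + q ^ 2))

/-- The q-antisymmetriser `A_{k}^{c₁…c_k}_{a₁…a_k}`: for `1 ≤ k ≤ 4` it is
`(-1)^k / n_k` times `ε^{z_{4-k}…z₁ c_k…c₁} ε_{z₁…z_{4-k} a₁…a_k}` summed over `z`
(up to the naming of the summation indices), and zero for `k > 4`. -/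
def antisymmetriser (q : ℝ) (k : ℕ) (c a : Fin k → Fin 4) : ℂ :=
  if k = 0 then 1 else if 4 < k then 0 else
    (-1) ^ k / (normFactor q k : ℂ) * ∑ z : Fin (4 - k) → Fin 4,
      epsUp q (List.ofFn c ++ List.ofFn z).reverse * epsLow q (List.ofFn z ++ List.ofFn a)

/-- `e_{a₁…a_p} = dx_{b₁} ⊗ … ⊗ dx_{b_p} A_{p}^{b₁…b_p}_{a₁…a_p}`. An element of the linear
component of the `p`-fold tensor product is given by its coefficients with respect to the
`dx_{b₁} ⊗ … ⊗ dx_{b_p}`. For `p = 0` this is the basis element `e = 1` of `ℂ`. -/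
def wedgeBasis (q : ℝ) (p : ℕ) (a : Fin p → Fin 4) : (Fin p → Fin 4) → ℂ :=
  fun b => antisymmetriser q p b a

/-- `Λ_p`, the span of the `e_{a₁…a_p}`. -/
def Lam (q : ℝ) (p : ℕ) : Submodule ℂ ((Fin p → Fin 4) → ℂ) :=
  Submodule.span ℂ (Set.range (wedgeBasis q p))

/-- `e_{a₁…a_p}` as an element of `Λ_p`. -/
def e (q : ℝ) {p : ℕ} (a : Fin p → Fin 4) : Lam q p :=
  ⟨wedgeBasis q p a, Submodule.subset_span ⟨a, rfl⟩⟩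

/-- `p`-forms on q-Minkowski space: linear maps `Λ_p → M_q`. -/
abbrev Form (q : ℝ) (p : ℕ) : Type := Lam q p →ₗ[ℂ] Mq q

/-- The `p`-form `e_{a₁…a_p} ↦ T_{[a₁…a_p]}`: the restriction to `Λ_p` of the linear map
`dx_{b₁} ⊗ … ⊗ dx_{b_p} ↦ T_{b₁…b_p}`. -/
def ofTensor (q : ℝ) (p : ℕ) : ((Fin p → Fin 4) → Mq q) →ₗ[ℂ] Form q p where
  toFun T := Fintype.linearCombination ℂ T ∘ₗ (Lam q p).subtype
  map_add' S T := by
    ext v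
    simp [Fintype.linearCombination_apply, Finset.sum_add_distrib]
  map_smul' r T := by
    ext v
    simp [Fintype.linearCombination_apply, Finset.smul_sum, smul_comm r]

theorem ofTensor_e (q : ℝ) (p : ℕ) (T : (Fin p → Fin 4) → Mq q) (a : Fin p → Fin 4) :
    ofTensor q p T (e q a) = ∑ c, antisymmetriser q p c a • T c := rfl

/-- The components `w_{[a₁…a_p]} = w(e_{a₁…a_p})` of a form. -/
def comp (q : ℝ) (p : ℕ) : Form q p →ₗ[ℂ] ((Fin p → Fin 4) → Mq q) where
  toFun w a := w (e q a)
  map_add' _ _ := rfl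
  map_smul' _ _ := rfl

/-- The q-exterior derivative `Ω_p → Ω_{p+1}`,
`dw(e_{a₁…a_{p+1}}) = ∂_{[a₁} w_{a₂…a_{p+1}]}`. -/
def extDeriv (q : ℝ) (hq : q ≠ 0) (p : ℕ) : Form q p →ₗ[ℂ] Form q (p + 1) :=
  ofTensor q (p + 1) ∘ₗ LinearMap.pi fun a =>
    partialLow q hq (a 0) ∘ₗ LinearMap.proj (Fin.tail a) ∘ₗ comp q p

/-- The q-Hodge star operator `Ω_p → Ω_r` for `p + r = 4` (zero otherwise),
`⋆w(e_{a₁…a_r}) = n_p^{-1/2} ε_{a₁…a_r b₁…b_p} ĝ^{b₁ c_p} ⋯ ĝ^{b_p c₁} w_{[c₁…c_p]}`. -/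
def hodge (q : ℝ) (p r : ℕ) : Form q p →ₗ[ℂ] Form q r :=
  ofTensor q r ∘ₗ LinearMap.pi fun a =>
    ∑ c : Fin p → Fin 4,
      (((Real.sqrt (normFactor q p))⁻¹ : ℝ) * ∑ b : Fin p → Fin 4,
        epsLow q (List.ofFn a ++ List.ofFn b) * ∏ i, unitMetric q (b i) (c i.rev) : ℂ) •
      (LinearMap.proj c ∘ₗ comp q p)

/-- The exterior algebra `Ω = ⨁_{p=0}^4 Ω_p` as a vector space. -/
abbrev Omega (q : ℝ) : Type := (p : Fin 5) → Form q p

/-- `d` on `Ω`; it vanishes on 4-forms since `Ω_5 = 0`. -/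
def d (q : ℝ) (hq : q ≠ 0) : Omega q →ₗ[ℂ] Omega q :=
  LinearMap.pi (Fin.cases 0 fun p : Fin 4 =>
    extDeriv q hq p ∘ₗ LinearMap.proj (φ := fun p : Fin 5 => Form q p) p.castSucc)

/-- The Hodge star on `Ω`. -/
def hodgeStar (q : ℝ) : Omega q →ₗ[ℂ] Omega q :=
  LinearMap.pi fun r => hodge q r.rev r ∘ₗ LinearMap.proj r.rev

/-- The q-coderivative `δ = ⋆ d ⋆`. -/
def coderiv (q : ℝ) (hq : q ≠ 0) : Omega q →ₗ[ℂ] Omega q := hodgeStar q ∘ₗ d q hq ∘ₗ hodgeStar q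

/-- The q-Laplace-Beltrami operator `Δ = δ d + d δ`. -/
def laplaceBeltrami (q : ℝ) (hq : q ≠ 0) : Omega q →ₗ[ℂ] Omega q :=
  coderiv q hq ∘ₗ d q hq + d q hq ∘ₗ coderiv q hq

/-- The inclusion `Ω_0 → Ω`. -/
def ofZeroForm (q : ℝ) : Form q 0 →ₗ[ℂ] Omega q :=
  LinearMap.single ℂ (fun p : Fin 5 => Form q p) 0

end

end QMinkowski

open scoped BigOperators Matrix

namespace QMinkowski

noncomputable section

/-! The Hodge dual of a 0-form has degree 4 and is killed by `d`, so `δφ = 0` and `Δφ = ⋆d⋆dφ`. This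
composite is computed in components. Since `A_{1}` is the identity, `dφ` has components `∂_a φ`.
Each `⋆` and `d` brings in an antisymmetriser, hence a product of an upper and a lower `ε`; every
such product meets another `ε` and collapses to a diagonal matrix.

The q-deformed `ε` is cyclic only up to weights: `ε_{hbcd} = -w(h) ε_{bcdh}` with `w = (1, q⁻², q²,
1)`, which is `twist`. Dualising the 1-form produces `n₁ w⁻¹` (`eps_contract_cyclic'`),
differentiating the resulting 3-form produces `n₁ w` (`eps_contract_cyclic`), and the weights
cancel. What remains is `ĝ^{ab} ∂_a ∂_b φ = (q + q⁻¹) □φ` times a scalar. The last `⋆` contributes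
`ε^{dcba} ε_{abcd} = n₄` (`eps_contract_all`), which cancels the `1/n₄` of `A_{4}`.

Altogether `Δφ = -(n₁/n₄)^{1/2} (q + q⁻¹) □φ` (`hodge_extDeriv_hodge_extDeriv_e`). As `n₄ = n₁ (q +
q⁻¹)²`, the constant is minus the sign of `q`; only its being non-zero is needed. About the `∂_a`
nothing but linearity enters.

The contractions are finite identities between Laurent polynomials in `q²`; after clearing
denominators they are decided on integer coefficient lists. -/

/-! ### Integer polynomial tables for `ε` and `ĝ`, and their contractions. -/

/-- `q² ε_{abcd}` as polynomials in `q²`. -/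
def tabEpsLow : Fin 4 → Fin 4 → Fin 4 → Fin 4 → List ℤ
  | 0, 1, 2, 3 => [0, 1] | 0, 1, 3, 2 => [-1] | 0, 2, 1, 3 => [0, -1] | 0, 2, 3, 1 => [0, 0, 1]
  | 0, 3, 0, 3 => [0, 1, -1] | 0, 3, 1, 2 => [0, 1] | 0, 3, 2, 1 => [0, -1]
  | 0, 3, 3, 3 => [-1, 1] | 1, 0, 2, 3 => [0, -1] | 1, 0, 3, 2 => [1] | 1, 2, 0, 3 => [0, 1]
  | 1, 2, 3, 0 => [0, -1] | 1, 3, 0, 2 => [-1] | 1, 3, 2, 0 => [1] | 1, 3, 2, 3 => [1, -1]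
  | 2, 0, 1, 3 => [0, 1] | 2, 0, 3, 1 => [0, 0, -1] | 2, 1, 0, 3 => [0, -1] | 2, 1, 3, 0 => [0, 1]
  | 2, 3, 0, 1 => [0, 0, 1] | 2, 3, 1, 0 => [0, 0, -1] | 2, 3, 1, 3 => [0, 1, -1]
  | 3, 0, 1, 2 => [0, -1] | 3, 0, 2, 1 => [0, 1] | 3, 0, 3, 0 => [0, -1, 1]
  | 3, 0, 3, 3 => [1, -1] | 3, 1, 0, 2 => [0, 1] | 3, 1, 2, 0 => [0, -1] | 3, 1, 3, 2 => [-1, 1]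
  | 3, 2, 0, 1 => [0, -1] | 3, 2, 1, 0 => [0, 1] | 3, 2, 3, 1 => [0, -1, 1]
  | 3, 3, 0, 3 => [-1, 1] | 3, 3, 3, 0 => [1, -1]
  | _, _, _, _ => []

/-- `q² ε^{abcd}` as polynomials in `q²`. -/
def tabEpsUp : Fin 4 → Fin 4 → Fin 4 → Fin 4 → List ℤ
  | 0, 0, 0, 3 => [0, 1, -1] | 0, 0, 3, 0 => [0, -1, 1] | 0, 1, 0, 2 => [0, -1, 1]
  | 0, 1, 2, 3 => [0, 0, 1] | 0, 1, 3, 2 => [0, 0, -1] | 0, 2, 0, 1 => [-1, 1]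
  | 0, 2, 1, 3 => [0, 0, -1] | 0, 2, 3, 1 => [0, 0, 1] | 0, 3, 0, 0 => [0, 1, -1]
  | 0, 3, 0, 3 => [0, -1, 1] | 0, 3, 1, 2 => [0, 0, 1] | 0, 3, 2, 1 => [0, 0, -1]
  | 1, 0, 2, 0 => [0, 1, -1] | 1, 0, 2, 3 => [0, 0, 0, -1] | 1, 0, 3, 2 => [0, 0, 0, 1]
  | 1, 2, 0, 3 => [0, 0, 1] | 1, 2, 3, 0 => [0, 0, -1] | 1, 3, 0, 2 => [0, 0, 0, -1]
  | 1, 3, 2, 0 => [0, 0, 1] | 2, 0, 1, 0 => [1, -1] | 2, 0, 1, 3 => [0, 1] | 2, 0, 3, 1 => [0, -1]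
  | 2, 1, 0, 3 => [0, 0, -1] | 2, 1, 3, 0 => [0, 0, 1] | 2, 3, 0, 1 => [0, 1]
  | 2, 3, 1, 0 => [0, 0, -1] | 3, 0, 0, 0 => [0, -1, 1] | 3, 0, 1, 2 => [0, 0, -1]
  | 3, 0, 2, 1 => [0, 0, 1] | 3, 0, 3, 0 => [0, 1, -1] | 3, 1, 0, 2 => [0, 0, 0, 1]
  | 3, 1, 2, 0 => [0, 0, -1] | 3, 2, 0, 1 => [0, -1] | 3, 2, 1, 0 => [0, 0, 1]
  | _, _, _, _ => []

/-- `q² ĝ^{ab}` as polynomials in `q²`. -/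
def tabMetric : Fin 4 → Fin 4 → List ℤ
  | 0, 0 => [1, -1] | 0, 3 => [0, 1] | 1, 2 => [0, -1] | 2, 1 => [0, 0, -1] | 3, 0 => [0, 1]
  | _, _ => []

/-- Every table carries a factor `q²`: there are five on the right and one on the left, and the four
leading zeros supply the missing `q^8`. -/
theorem tabEpsUp_spec : ∀ a b c d : Fin 4,
    peq (0 :: 0 :: 0 :: 0 :: tabEpsUp a b c d)
      (psum4 fun i => psum4 fun j => psum4 fun k => psum4 fun l =>
        pmul (pmul (pmul (pmul (tabEpsLow i j k l) (tabMetric i a)) (tabMetric j b))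
          (tabMetric k c)) (tabMetric l d)) = true := by
  decide +kernel

/-- With `t = q²`, the diagonal value `-2t²(1 + t + t²)` is `-q⁴ n₁`, where `q⁴` is the scaling of
the two `ε` tables. -/
theorem tabEps_contract_last : ∀ a h : Fin 4,
    peq (psum4 fun b => psum4 fun c => psum4 fun d => pmul (tabEpsUp d c b a) (tabEpsLow b c d h))
      (if a = h then [0, 0, -2, -2, -2] else []) = true := by
  decide +kernel

/-- `q²` times the weights `1, q⁻², q², 1`. -/
def tabTwist : Fin 4 → List ℤ := ![[0, 1], [1], [0, 0, 1], [0, 1]]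

/-- Moving `h` from the last place to the first multiplies `ε` by minus the weight of `h`. The extra
factor `[0, 1]`, i.e. `q²`, matches the scaling of `tabTwist`. -/
theorem tabEps_contract_cyclic : ∀ a h : Fin 4,
    peq (pmul [0, 1] (psum4 fun b => psum4 fun c => psum4 fun d =>
        pmul (tabEpsUp d c b a) (tabEpsLow h b c d)))
      (if a = h then pmul [0, 0, 2, 2, 2] (tabTwist a) else []) = true := by
  decide +kernel

/-- Here the inverse weight appears; it is multiplied over to the left so that both sides stay
polynomial. -/
theorem tabEps_contract_cyclic' : ∀ a h : Fin 4,
    peq (pmul (tabTwist a) (psum4 fun b => psum4 fun c => psum4 fun d =>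
        pmul (tabEpsUp a d c b) (tabEpsLow b c d h)))
      (if a = h then [0, 0, 0, 2, 2, 2] else []) = true := by
  decide +kernel

/-! ### The tables evaluate to the actual tensors. -/

theorem pev_tabEpsLow (q : ℝ) (hq : q ≠ 0) (a b c d : Fin 4) :
    pev ((q : ℂ) ^ 2) (tabEpsLow a b c d) = q ^ 2 * epsLow q [a, b, c, d] := by
  have h : (q : ℂ) ≠ 0 := by exact_mod_cast hq
  -- Only eleven values occur among the 256 entries. Each is verified once, and `key` transfers it
  -- to an entry whose two sides reduce to that value by `rfl`.
  have key : ∀ (m : List ℤ) (r : ℂ), pev ((q : ℂ) ^ 2) m = q ^ 2 * r →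
      ∀ (l : List ℤ) (_ : l = m) (s : ℂ) (_ : s = r),
      pev ((q : ℂ) ^ 2) l = q ^ 2 * s := by
    rintro m r hmr _ rfl _ rfl
    exact hmr
  have h0 := key [] 0 (by simp [pev])
  have h1 := key [0, 1] 1 (by simp [pev])
  have h2 := key [0, -1] (-1) (by simp [pev])
  have h3 := key [1] ((q : ℂ)⁻¹ ^ 2) (by simp [pev, h])
  have h4 := key [-1] (-(q : ℂ)⁻¹ ^ 2) (by simp [pev, h])
  have h5 := key [0, 0, 1] ((q : ℂ) ^ 2) (by simp [pev])
  have h6 := key [0, 0, -1] (-(q : ℂ) ^ 2) (by simp [pev])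
  have h7 := key [0, 1, -1] (1 - (q : ℂ) ^ 2) (by simp only [pev]; push_cast; ring)
  have h8 := key [0, -1, 1] ((q : ℂ) ^ 2 - 1) (by simp only [pev]; push_cast; ring)
  have h9 := key [1, -1] ((q : ℂ)⁻¹ ^ 2 - 1) (by simp [pev]; field_simp; ring)
  have h10 := key [-1, 1] (1 - (q : ℂ)⁻¹ ^ 2) (by simp [pev]; field_simp; ring)
  fin_cases a <;> fin_cases b <;> fin_cases c <;> fin_cases d <;>
    first
      | exact h0 _ rfl _ rfl | exact h1 _ rfl _ rfl | exact h2 _ rfl _ rfl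
      | exact h3 _ rfl _ rfl | exact h4 _ rfl _ rfl | exact h5 _ rfl _ rfl
      | exact h6 _ rfl _ rfl | exact h7 _ rfl _ rfl | exact h8 _ rfl _ rfl
      | exact h9 _ rfl _ rfl | exact h10 _ rfl _ rfl

theorem sqrtq_mul_self (q : ℝ) : sqrtq q * sqrtq q = q := by
  rw [sqrtq, ← pow_two, ← Complex.cpow_nat_mul]
  norm_num

/-- Reality of `q` matters: `q² + 1` would vanish at `q = ±i`. -/
theorem ofReal_add_inv_ne_zero (q : ℝ) (hq : q ≠ 0) : (q : ℂ) + (q : ℂ)⁻¹ ≠ 0 := by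
  have h : q + q⁻¹ ≠ 0 := by
    intro h
    field_simp at h
    nlinarith [sq_nonneg q]
  exact_mod_cast h

theorem pev_tabMetric (q : ℝ) (hq : q ≠ 0) (a b : Fin 4) :
    pev ((q : ℂ) ^ 2) (tabMetric a b) = q ^ 2 * unitMetric q a b := by
  have h : (q : ℂ) ≠ 0 := by exact_mod_cast hq
  have hs := sqrtq_mul_self q
  have hs0 : sqrtq q ≠ 0 := fun h0 => h (by rw [← hs, h0, zero_mul])
  have hinv : (spinorLow q)⁻¹ = !![0, -1 / sqrtq q; sqrtq q, 0] := by
    apply Matrix.inv_eq_right_inv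
    ext i j
    fin_cases i <;> fin_cases j <;> simp [spinorLow, Matrix.mul_apply, Fin.sum_univ_two, hs0, neg_div]
  -- The factor in `ĝ` cancels the normalisation of `g`; the remaining square roots combine in
  -- pairs, leaving Laurent polynomials in `q`.
  have hm : unitMetric q a b = ∑ C : Fin 2, ∑ D : Fin 2,
      spinorLow q (spin a).1 C * rMat q ((spin a).2, C) (D, (spin b).1) *
        spinorUp q D (spin b).2 := by
    have h1 := ofReal_add_inv_ne_zero q hq
    rw [unitMetric, Matrix.smul_apply, metric, Matrix.of_apply, smul_eq_mul, ← mul_assoc,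
      mul_one_div_cancel h1, one_mul]
  rw [hm]
  simp only [Fin.sum_univ_two, spinorUp, hinv, Matrix.transpose_apply]
  fin_cases a <;> fin_cases b <;>
    simp [tabMetric, pev, spin, spinorLow, rMat, finProdFinEquiv, hs0, neg_div]
  · generalize sqrtq q = s at hs hs0
    rw [← hs]
    field_simp
    ring
  · generalize sqrtq q = s at hs hs0
    rw [← hs]
    field_simp
  · exact Or.inl (by linear_combination -(q : ℂ) * hs)

theorem pev_tabEpsUp (q : ℝ) (hq : q ≠ 0) (a b c d : Fin 4) :
    pev ((q : ℂ) ^ 2) (tabEpsUp a b c d) = q ^ 2 * epsUp q [a, b, c, d] := by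
  have h : (q : ℂ) ≠ 0 := by exact_mod_cast hq
  have := pev_peq ((q : ℂ) ^ 2) _ _ (tabEpsUp_spec a b c d)
  simp only [pev_psum4, pev_pmul, pev_tabEpsLow q hq, pev_tabMetric q hq] at this
  simp only [pev] at this
  apply mul_left_cancel₀ (pow_ne_zero 8 h)
  rw [epsUp]
  simp only [Finset.mul_sum]
  refine Eq.trans ?_ (this.trans ?_)
  · push_cast; ring
  · refine Finset.sum_congr rfl fun i _ => Finset.sum_congr rfl fun j _ =>
      Finset.sum_congr rfl fun k _ => Finset.sum_congr rfl fun l _ => ?_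
    ring

/-! ### Contractions of the upper with the lower `ε` over `ℂ`. -/

/-- `n_1 = n_3`. -/
def normOne (q : ℝ) : ℂ := 2 * (1 + (q : ℂ) ^ 2 + (q : ℂ) ^ 4)

/-- The weights by which `ε` changes under cyclic permutations of its indices. -/
def twist (q : ℝ) : Fin 4 → ℂ := ![1, (q : ℂ)⁻¹ ^ 2, (q : ℂ) ^ 2, 1]

theorem pev_tabTwist (q : ℝ) (hq : q ≠ 0) (a : Fin 4) :
    pev ((q : ℂ) ^ 2) (tabTwist a) = q ^ 2 * twist q a := by
  have h : (q : ℂ) ≠ 0 := by exact_mod_cast hq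
  fin_cases a <;> simp [tabTwist, twist, pev, h]

theorem twist_ne_zero (q : ℝ) (hq : q ≠ 0) (a : Fin 4) : twist q a ≠ 0 := by
  fin_cases a <;> simp [twist, hq]

/-- The contraction inside `A_{1}`; it makes `A_{1}` the identity. -/
theorem eps_contract_last (q : ℝ) (hq : q ≠ 0) (a h : Fin 4) :
    ∑ b, ∑ c, ∑ d, epsUp q [d, c, b, a] * epsLow q [b, c, d, h] =
      if a = h then -normOne q else 0 := by
  have h0 : (q : ℂ) ≠ 0 := by exact_mod_cast hq
  have := pev_peq ((q : ℂ) ^ 2) _ _ (tabEps_contract_last a h)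
  simp only [pev_psum4, pev_pmul, pev_tabEpsLow q hq, pev_tabEpsUp q hq,
    apply_ite (pev ((q : ℂ) ^ 2)), pev] at this
  apply mul_left_cancel₀ (pow_ne_zero 4 h0)
  simp only [Finset.mul_sum]
  refine Eq.trans ?_ (this.trans ?_)
  · refine Finset.sum_congr rfl fun b _ => Finset.sum_congr rfl fun c _ =>
      Finset.sum_congr rfl fun d _ => ?_
    ring
  · rw [normOne]
    split_ifs <;> push_cast <;> ring

/-- The contraction met when `d` acts on the dual of a 1-form; its trace gives `n₄`. -/
theorem eps_contract_cyclic (q : ℝ) (hq : q ≠ 0) (a h : Fin 4) :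
    ∑ b, ∑ c, ∑ d, epsUp q [d, c, b, a] * epsLow q [h, b, c, d] =
      if a = h then normOne q * twist q a else 0 := by
  have h0 : (q : ℂ) ≠ 0 := by exact_mod_cast hq
  have := pev_peq ((q : ℂ) ^ 2) _ _ (tabEps_contract_cyclic a h)
  simp only [pev_psum4, pev_pmul, pev_tabEpsLow q hq, pev_tabEpsUp q hq, pev_tabTwist q hq,
    apply_ite (pev ((q : ℂ) ^ 2))] at this
  simp only [pev] at this
  apply mul_left_cancel₀ (pow_ne_zero 6 h0)
  simp only [Finset.mul_sum] at this ⊢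
  refine Eq.trans ?_ (this.trans ?_)
  · refine Finset.sum_congr rfl fun b _ => Finset.sum_congr rfl fun c _ =>
      Finset.sum_congr rfl fun d _ => ?_
    push_cast
    ring
  · rw [normOne]
    split_ifs <;> push_cast <;> ring

/-- The contraction of `A_{3}` with the `ε` of the Hodge star on 1-forms. -/
theorem eps_contract_cyclic' (q : ℝ) (hq : q ≠ 0) (a h : Fin 4) :
    ∑ b, ∑ c, ∑ d, epsUp q [a, d, c, b] * epsLow q [b, c, d, h] =
      if a = h then normOne q * (twist q a)⁻¹ else 0 := by
  have h0 : (q : ℂ) ≠ 0 := by exact_mod_cast hq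
  have ht := twist_ne_zero q hq a
  have := pev_peq ((q : ℂ) ^ 2) _ _ (tabEps_contract_cyclic' a h)
  simp only [pev_psum4, pev_pmul, pev_tabEpsLow q hq, pev_tabEpsUp q hq, pev_tabTwist q hq,
    apply_ite (pev ((q : ℂ) ^ 2))] at this
  simp only [pev] at this
  apply mul_left_cancel₀ (mul_ne_zero (pow_ne_zero 6 h0) ht)
  simp only [Finset.mul_sum] at this ⊢
  refine Eq.trans ?_ (this.trans ?_)
  · refine Finset.sum_congr rfl fun b _ => Finset.sum_congr rfl fun c _ =>
      Finset.sum_congr rfl fun d _ => ?_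
    ring
  · rw [normOne]
    split_ifs
    · field_simp
      push_cast
      ring
    · ring

/-! ### Sums over multi-indices, and the antisymmetrisers of degree 1, 3 and 4. -/

theorem sum_fun_fin_zero {M : Type*} [AddCommMonoid M] (F : (Fin 0 → Fin 4) → M) :
    ∑ f, F f = F ![] := by
  rw [Fintype.sum_unique]
  exact congrArg F (Subsingleton.elim _ _)

theorem sum_fun_fin_succ {M : Type*} [AddCommMonoid M] {n : ℕ} (F : (Fin (n + 1) → Fin 4) → M) :
    ∑ f, F f = ∑ a, ∑ g : Fin n → Fin 4, F (Matrix.vecCons a g) := by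
  rw [← (Fin.consEquiv fun _ => Fin 4).sum_comp, Fintype.sum_prod_type]
  rfl

theorem normOne_ne_zero (q : ℝ) : normOne q ≠ 0 := by
  have h : (2 * (1 + q ^ 2 + q ^ 4) : ℝ) ≠ 0 := by positivity
  rw [normOne]
  exact_mod_cast h

theorem normFactor_one (q : ℝ) : (normFactor q 1 : ℂ) = normOne q := by
  simp [normFactor, normOne]

theorem normFactor_three (q : ℝ) : (normFactor q 3 : ℂ) = normOne q := by
  simp [normFactor, normOne]

theorem normFactor_pos (q : ℝ) (hq : q ≠ 0) (p : ℕ) : 0 < normFactor q p := by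
  unfold normFactor
  split <;> positivity

theorem sum_fun_fin_three {M : Type*} [AddCommMonoid M] (F : Fin 4 → Fin 4 → Fin 4 → M) :
    ∑ v : Fin 3 → Fin 4, F (v 0) (v 1) (v 2) = ∑ a, ∑ b, ∑ c, F a b c := by
  simp only [sum_fun_fin_succ, sum_fun_fin_zero]
  rfl

/-- `ε^{dcba} ε_{abcd} = n_4`. -/
theorem eps_contract_all (q : ℝ) (hq : q ≠ 0) :
    ∑ v : Fin 4 → Fin 4, epsUp q [v 3, v 2, v 1, v 0] * epsLow q [v 0, v 1, v 2, v 3] =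
      normFactor q 4 := by
  have h0 : (q : ℂ) ≠ 0 := by exact_mod_cast hq
  calc ∑ v : Fin 4 → Fin 4, epsUp q [v 3, v 2, v 1, v 0] * epsLow q [v 0, v 1, v 2, v 3]
      = ∑ a, ∑ b, ∑ c, ∑ d, epsUp q [d, c, b, a] * epsLow q [a, b, c, d] := by
        simp only [sum_fun_fin_succ, sum_fun_fin_zero]
        rfl
    _ = ∑ a, normOne q * twist q a :=
        Finset.sum_congr rfl fun a _ => (eps_contract_cyclic q hq a a).trans (if_pos rfl)
    -- The weights sum to `2 + q² + q⁻² = (q + q⁻¹)²`, which is `n₄ / n₁`.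
    _ = normFactor q 4 := by
        simp only [Fin.sum_univ_four, twist, normOne, normFactor, Matrix.cons_val]
        push_cast
        field_simp
        ring

theorem antisymmetriser_one (q : ℝ) (hq : q ≠ 0) (c a : Fin 4) :
    antisymmetriser q 1 ![c] ![a] = if c = a then 1 else 0 := by
  have hn := normOne_ne_zero q
  have h := eps_contract_last q hq c a
  rw [antisymmetriser, if_neg (by norm_num), if_neg (by norm_num), normFactor_one]
  -- Reduces `Fin (4 - 1)` to `Fin 3`, so that the multi-index sum can be unfolded one index at a
  -- time.
  change (-1) ^ 1 / normOne q * ∑ z : Fin 3 → Fin 4, _ = _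
  simp only [sum_fun_fin_succ, sum_fun_fin_zero]
  simp only [List.ofFn_succ, List.ofFn_zero]
  simp only [Matrix.cons_val_zero, Matrix.cons_val_succ, List.cons_append, List.nil_append,
    List.reverse_cons, List.reverse_nil]
  rw [h]
  split_ifs <;> field_simp
  simp

theorem antisymmetriser_three (q : ℝ) (v a : Fin 3 → Fin 4) :
    antisymmetriser q 3 v a =
      -(normOne q)⁻¹ * ∑ z, epsUp q [z, v 2, v 1, v 0] * epsLow q [z, a 0, a 1, a 2] := by
  rw [antisymmetriser, if_neg (by norm_num), if_neg (by norm_num), normFactor_three]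
  change (-1) ^ 3 / normOne q * ∑ z : Fin 1 → Fin 4, _ = _
  simp only [sum_fun_fin_succ, sum_fun_fin_zero]
  rw [show ((-1) ^ 3 / normOne q : ℂ) = -(normOne q)⁻¹ by ring]
  rfl

theorem antisymmetriser_four (q : ℝ) (v a : Fin 4 → Fin 4) :
    antisymmetriser q 4 v a = (normFactor q 4 : ℂ)⁻¹ *
      (epsUp q [v 3, v 2, v 1, v 0] * epsLow q [a 0, a 1, a 2, a 3]) := by
  rw [antisymmetriser, if_neg (by norm_num), if_neg (by norm_num)]
  change (-1) ^ 4 / (normFactor q 4 : ℂ) * ∑ z : Fin 0 → Fin 4, _ = _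
  rw [sum_fun_fin_zero, show ((-1) ^ 4 / (normFactor q 4 : ℂ) : ℂ) = (normFactor q 4 : ℂ)⁻¹ by ring]
  rfl

/-! ### The operators `d` and `⋆` in components. -/

theorem extDeriv_e (q : ℝ) (hq : q ≠ 0) (p : ℕ) (w : Form q p) (a : Fin (p + 1) → Fin 4) :
    extDeriv q hq p w (e q a) =
      ∑ c, antisymmetriser q (p + 1) c a • partialLow q hq (c 0) (w (e q (Fin.tail c))) := rfl

theorem hodge_e (q : ℝ) (p r : ℕ) (w : Form q p) (a : Fin r → Fin 4) :
    hodge q p r w (e q a) = ∑ v, antisymmetriser q r v a • ∑ c : Fin p → Fin 4,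
      (((Real.sqrt (normFactor q p))⁻¹ : ℝ) * ∑ b : Fin p → Fin 4,
        epsLow q (List.ofFn v ++ List.ofFn b) * ∏ i, unitMetric q (b i) (c i.rev) : ℂ) •
      w (e q c) := by
  simp [hodge, ofTensor_e, comp, LinearMap.sum_apply]

/-- `d` on 0-forms is `φ ↦ ∂_a φ`. -/
theorem extDeriv_zero_e (q : ℝ) (hq : q ≠ 0) (φ : Form q 0) (a : Fin 4) :
    extDeriv q hq 0 φ (e q ![a]) = partialLow q hq a (φ (e q ![])) := by
  rw [extDeriv_e]
  change ∑ c : Fin 1 → Fin 4, _ = _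
  simp only [sum_fun_fin_succ, sum_fun_fin_zero]
  rw [Finset.sum_eq_single a]
  · rw [antisymmetriser_one q hq, if_pos rfl, one_smul]
    rfl
  · intro c _ hc
    rw [antisymmetriser_one q hq, if_neg hc, zero_smul]
  · simp

/-- Pulls the sum over `t` inside, where it becomes the contraction of two `ε`: `t` is the triple of
indices that `A_{3}` shares with the Hodge star. -/
theorem sum_mul_sum_smul_sum {ι κ μ M : Type*} [Fintype ι] [Fintype κ] [Fintype μ]
    [AddCommMonoid M] [Module ℂ M] (k s : ℂ) (A : ι → κ → ℂ) (B : κ → ℂ) (C : ι → μ → ℂ)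
    (Y : μ → M) :
    ∑ t, (k * ∑ z, A t z * B z) • s • ∑ b, C t b • Y b =
      (k * s) • ∑ z, B z • ∑ b, (∑ t, A t z * C t b) • Y b := by
  have h : ∀ t, (k * ∑ z, A t z * B z) • s • ∑ b, C t b • Y b =
      ∑ z, ∑ b, (k * s * B z * (A t z * C t b)) • Y b := by
    intro t
    rw [Finset.mul_sum, Finset.sum_smul]
    simp only [Finset.smul_sum, smul_smul]
    refine Finset.sum_congr rfl fun z _ => Finset.sum_congr rfl fun b _ => ?_
    congr 1
    ring
  simp only [h]
  rw [Finset.sum_comm, Finset.smul_sum]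
  refine Finset.sum_congr rfl fun z _ => ?_
  rw [Finset.sum_comm, smul_smul, Finset.smul_sum]
  refine Finset.sum_congr rfl fun b _ => ?_
  rw [smul_smul, Finset.mul_sum, Finset.sum_smul]

/-- The analogous exchange for the derivative of a dual 1-form, isolating the contraction over `t`.
-/
theorem sum_smul_smul_sum {ι κ M : Type*} [Fintype ι] [Fintype κ]
    [AddCommMonoid M] [Module ℂ M] (m : ℂ) (A : ι → ℂ) (B : κ → ℂ) (C : κ → ι → ℂ) (Y : κ → M) :
    ∑ t, A t • m • ∑ z, (B z * C z t) • Y z = m • ∑ z, ((∑ t, A t * C z t) * B z) • Y z := by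
  simp only [Finset.smul_sum, Finset.sum_mul, Finset.sum_smul, smul_smul]
  rw [Finset.sum_comm]
  refine Finset.sum_congr rfl fun z _ => Finset.sum_congr rfl fun t _ => ?_
  congr 1
  ring

/-- The Hodge dual of a 1-form. -/
theorem hodge_one_three_e (q : ℝ) (hq : q ≠ 0) (w : Form q 1) (a : Fin 3 → Fin 4) :
    hodge q 1 3 w (e q a) = (-((Real.sqrt (normFactor q 1))⁻¹ : ℝ) : ℂ) •
      ∑ z, ((twist q z)⁻¹ * epsLow q [z, a 0, a 1, a 2]) •
        ∑ h, unitMetric q z h • w (e q ![h]) := by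
  have hn := normOne_ne_zero q
  have hY : ∀ (s : ℂ) (v : Fin 3 → Fin 4),
      ∑ c : Fin 1 → Fin 4, (s * ∑ b : Fin 1 → Fin 4,
        epsLow q (List.ofFn v ++ List.ofFn b) * ∏ i, unitMetric q (b i) (c i.rev) : ℂ) •
      w (e q c) =
      s • ∑ b, epsLow q [v 0, v 1, v 2, b] • ∑ h, unitMetric q b h • w (e q ![h]) := by
    intro s v
    simp only [sum_fun_fin_succ, sum_fun_fin_zero, Fin.prod_univ_one, Finset.smul_sum, smul_smul,
      Finset.mul_sum, Finset.sum_smul]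
    rw [Finset.sum_comm]
    refine Finset.sum_congr rfl fun b _ => Finset.sum_congr rfl fun h _ => ?_
    rfl
  rw [hodge_e]
  simp only [hY, antisymmetriser_three]
  rw [sum_mul_sum_smul_sum]
  -- The contraction forces `z = b`, so the antisymmetrised dual is again a single `ε`, with its
  -- free index now in first place and an inverse weight.
  have hU : ∀ z b : Fin 4, ∑ v : Fin 3 → Fin 4,
      epsUp q [z, v 2, v 1, v 0] * epsLow q [v 0, v 1, v 2, b] =
        if z = b then normOne q * (twist q z)⁻¹ else 0 := by
    intro z b
    rw [← eps_contract_cyclic' q hq z b]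
    exact sum_fun_fin_three fun x y u => epsUp q [z, u, y, x] * epsLow q [x, y, u, b]
  simp only [hU, ite_smul, zero_smul, Finset.sum_ite_eq, Finset.mem_univ, if_true]
  simp only [Finset.smul_sum, smul_smul]
  refine Finset.sum_congr rfl fun z _ => Finset.sum_congr rfl fun h _ => ?_
  congr 1
  field_simp

/-- `d` on 3-forms. -/
theorem extDeriv_three_e (q : ℝ) (hq : q ≠ 0) (w : Form q 3) (a : Fin 4 → Fin 4) :
    extDeriv q hq 3 w (e q a) =
      ((normFactor q 4 : ℂ)⁻¹ * epsLow q [a 0, a 1, a 2, a 3]) •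
        ∑ r, ∑ v : Fin 3 → Fin 4,
          epsUp q [v 2, v 1, v 0, r] • partialLow q hq r (w (e q v)) := by
  rw [extDeriv_e]
  change ∑ c : Fin 4 → Fin 4, antisymmetriser q 4 c a • _ = _
  rw [sum_fun_fin_succ]
  simp only [antisymmetriser_four, Finset.smul_sum, smul_smul]
  refine Finset.sum_congr rfl fun r _ => Finset.sum_congr rfl fun v _ => ?_
  rw [mul_comm (epsUp q _), ← mul_assoc]
  rfl

/-- The Hodge dual of a 4-form. -/
theorem hodge_four_zero_e (q : ℝ) (w : Form q 4) :
    hodge q 4 0 w (e q ![]) = (((Real.sqrt (normFactor q 4))⁻¹ : ℝ) : ℂ) •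
      ∑ c : Fin 4 → Fin 4, epsUp q [c 3, c 2, c 1, c 0] • w (e q c) := by
  rw [hodge_e, sum_fun_fin_zero, antisymmetriser, if_pos rfl, one_smul]
  simp only [Finset.smul_sum, smul_smul]
  refine Finset.sum_congr rfl fun c _ => ?_
  congr 2
  -- The star pairs `b` with `c` in reversed order, so raising all four indices yields `ε` with
  -- upper indices read backwards.
  rw [epsUp]
  simp only [sum_fun_fin_succ, sum_fun_fin_zero, Fin.prod_univ_four]
  refine Finset.sum_congr rfl fun i _ => Finset.sum_congr rfl fun j _ =>
      Finset.sum_congr rfl fun k _ => Finset.sum_congr rfl fun l _ => ?_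
  rw [← mul_assoc, ← mul_assoc, ← mul_assoc]
  rfl

theorem unitMetric_apply (q : ℝ) (a b : Fin 4) :
    unitMetric q a b = ((q : ℂ) + (q : ℂ)⁻¹) * metric q a b := rfl

/-- `⋆ d ⋆ d` on 0-forms is a multiple of the q-d'Alembert operator. -/
theorem hodge_extDeriv_hodge_extDeriv_e (q : ℝ) (hq : q ≠ 0) (φ : Form q 0) :
    hodge q 4 0 (extDeriv q hq 3 (hodge q 1 3 (extDeriv q hq 0 φ))) (e q ![]) =
      (-(((Real.sqrt (normFactor q 4))⁻¹ : ℝ) : ℂ) * ((Real.sqrt (normFactor q 1))⁻¹ : ℝ) *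
        normOne q * ((q : ℂ) + (q : ℂ)⁻¹)) • dAlembert q hq (φ (e q ![])) := by
  have h4 : (normFactor q 4 : ℂ) ≠ 0 := by exact_mod_cast (normFactor_pos q hq 4).ne'
  have hU : ∀ r z : Fin 4, ∑ v : Fin 3 → Fin 4,
      epsUp q [v 2, v 1, v 0, r] * epsLow q [z, v 0, v 1, v 2] =
        if r = z then normOne q * twist q r else 0 := by
    intro r z
    rw [← eps_contract_cyclic q hq r z]
    exact sum_fun_fin_three fun x y u => epsUp q [u, y, x, r] * epsLow q [z, x, y, u]
  set κ : ℂ := (((Real.sqrt (normFactor q 1))⁻¹ : ℝ) : ℂ)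
  -- This is the factor of the 4-form `d⋆dφ` that does not depend on the component; the rest is
  -- `ε_{abcd} / n₄`.
  have hX : ∑ r, ∑ v : Fin 3 → Fin 4, epsUp q [v 2, v 1, v 0, r] •
      partialLow q hq r (hodge q 1 3 (extDeriv q hq 0 φ) (e q v)) =
      (-κ * normOne q * ((q : ℂ) + (q : ℂ)⁻¹)) • dAlembert q hq (φ (e q ![])) := by
    have hr : ∀ r, ∑ v : Fin 3 → Fin 4, epsUp q [v 2, v 1, v 0, r] •
        partialLow q hq r (hodge q 1 3 (extDeriv q hq 0 φ) (e q v)) =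
        ∑ b, (-κ * normOne q * unitMetric q r b) •
          partialLow q hq r (partialLow q hq b (φ (e q ![]))) := by
      intro r
      simp only [hodge_one_three_e q hq, extDeriv_zero_e q hq, map_smul, map_sum]
      set Y : Fin 4 → Mq q := fun z => ∑ h, unitMetric q z h •
        partialLow q hq r (partialLow q hq h (φ (e q ![]))) with hYdef
      calc _ = (-κ) • ∑ z, ((∑ v : Fin 3 → Fin 4,
            epsUp q [v 2, v 1, v 0, r] * epsLow q [z, v 0, v 1, v 2]) * (twist q z)⁻¹) • Y z :=
            sum_smul_smul_sum _ _ _ _ _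
        _ = _ := by
            -- The weight from `hU` meets the inverse weight of `hodge_one_three_e` at the same
            -- index and cancels it.
            simp only [hU, ite_mul, zero_mul, ite_smul, zero_smul, Finset.sum_ite_eq,
              Finset.mem_univ, if_true, mul_inv_cancel_right₀ (twist_ne_zero q hq r)]
            simp only [hYdef, Finset.smul_sum, smul_smul, mul_assoc]
    simp only [hr, dAlembert, LinearMap.sum_apply, LinearMap.smul_apply, LinearMap.comp_apply,
      Finset.smul_sum, smul_smul, unitMetric_apply, mul_assoc]
  rw [hodge_four_zero_e]
  simp only [extDeriv_three_e, hX, smul_smul]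
  rw [← Finset.sum_smul, smul_smul]
  congr 1
  have hN : ∑ c : Fin 4 → Fin 4, epsUp q [c 3, c 2, c 1, c 0] *
      ((normFactor q 4 : ℂ)⁻¹ * epsLow q [c 0, c 1, c 2, c 3] *
        (-κ * normOne q * ((q : ℂ) + (q : ℂ)⁻¹))) =
      -κ * normOne q * ((q : ℂ) + (q : ℂ)⁻¹) := by
    calc _ = (∑ c : Fin 4 → Fin 4, epsUp q [c 3, c 2, c 1, c 0] *
        epsLow q [c 0, c 1, c 2, c 3]) * ((normFactor q 4 : ℂ)⁻¹ *
        (-κ * normOne q * ((q : ℂ) + (q : ℂ)⁻¹))) := by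
          rw [Finset.sum_mul]
          exact Finset.sum_congr rfl fun c _ => by ring
      _ = _ := by rw [eps_contract_all q hq, mul_inv_cancel_left₀ h4]
  rw [hN]
  ring

/-! ### Reduction of `Δ` on 0-forms to `⋆d⋆d`. -/

/-- `Λ_0` is spanned by one vector, because the empty multi-index is the only one. -/
theorem form_zero_eq_zero_iff (q : ℝ) (w : Form q 0) : w = 0 ↔ w (e q ![]) = 0 := by
  refine ⟨fun h => by rw [h]; rfl, fun h => ?_⟩
  ext ⟨v, hv⟩
  induction hv using Submodule.span_induction with
  | mem v hv =>
    obtain ⟨a, rfl⟩ := hv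
    exact (congrArg (fun a => w (e q a)) (Subsingleton.elim a ![])).trans h
  | zero => exact map_zero w
  | add u v hu hv h1 h2 =>
    have := map_add w ⟨u, hu⟩ ⟨v, hv⟩
    rw [h1, h2] at this
    exact this.trans (add_zero _)
  | smul r v hv h1 =>
    have := map_smul w r ⟨v, hv⟩
    rw [h1] at this
    exact this.trans (smul_zero _)

/-- The dual is concentrated in degree 4, whereas `d` reads only the components of degree 0 to 3. -/
theorem d_hodgeStar_ofZeroForm (q : ℝ) (hq : q ≠ 0) (φ : Form q 0) :
    d q hq (hodgeStar q (ofZeroForm q φ)) = 0 := by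
  ext r : 1
  refine Fin.cases rfl (fun p => ?_) r
  have h : hodgeStar q (ofZeroForm q φ) p.castSucc = 0 := by
    have : ofZeroForm q φ p.castSucc.rev = 0 := by
      rw [ofZeroForm, LinearMap.single_apply, Pi.single_eq_of_ne]
      rw [Fin.rev_castSucc]
      exact Fin.succ_ne_zero _
    change hodge q _ _ (ofZeroForm q φ p.castSucc.rev) = 0
    rw [this, map_zero]
  change extDeriv q hq p (hodgeStar q (ofZeroForm q φ) p.castSucc) = 0
  rw [h, map_zero]

/-- The inclusion `Ω_p → Ω`. -/
def ofForm (q : ℝ) (p : Fin 5) : Form q p →ₗ[ℂ] Omega q :=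
  LinearMap.single ℂ (fun p : Fin 5 => Form q p) p

theorem ofForm_same (q : ℝ) (p : Fin 5) (w : Form q p) : ofForm q p w p = w :=
  Pi.single_eq_same (M := fun p : Fin 5 => Form q p) p w

theorem ofForm_of_ne (q : ℝ) {p r : Fin 5} (h : r ≠ p) (w : Form q p) : ofForm q p w r = 0 :=
  Pi.single_eq_of_ne (M := fun p : Fin 5 => Form q p) h w

theorem d_ofZeroForm (q : ℝ) (hq : q ≠ 0) (φ : Form q 0) :
    d q hq (ofZeroForm q φ) = ofForm q 1 (extDeriv q hq 0 φ) := by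
  ext r : 1
  fin_cases r
  · rfl
  · rfl
  all_goals exact map_zero (extDeriv q hq _)

/-- Indexing by the target degree `r` lets the source degree be `r.rev` on the nose, which avoids
casts between form spaces. -/
theorem hodgeStar_ofForm (q : ℝ) (r : Fin 5) (w : Form q r.rev) :
    hodgeStar q (ofForm q r.rev w) = ofForm q r (hodge q r.rev r w) := by
  ext s : 1
  change hodge q s.rev s (ofForm q r.rev w s.rev) = _
  by_cases h : s = r
  · subst h
    rw [ofForm_same, ofForm_same]
  · rw [ofForm_of_ne q (Fin.rev_injective.ne h), ofForm_of_ne q h, map_zero]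

theorem d_ofForm_three (q : ℝ) (hq : q ≠ 0) (w : Form q 3) :
    d q hq (ofForm q 3 w) = ofForm q 4 (extDeriv q hq 3 w) := by
  ext r : 1
  fin_cases r
  all_goals first | rfl | exact map_zero (extDeriv q hq _)

set_option maxRecDepth 10000 in
theorem laplaceBeltrami_ofZeroForm (q : ℝ) (hq : q ≠ 0) (φ : Form q 0) :
    laplaceBeltrami q hq (ofZeroForm q φ) =
      ofZeroForm q (hodge q 4 0 (extDeriv q hq 3 (hodge q 1 3 (extDeriv q hq 0 φ)))) := by
  have h0 : coderiv q hq (ofZeroForm q φ) = 0 := by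
    change hodgeStar q (d q hq (hodgeStar q (ofZeroForm q φ))) = 0
    rw [d_hodgeStar_ofZeroForm, map_zero]
  rw [laplaceBeltrami, LinearMap.add_apply, LinearMap.comp_apply, LinearMap.comp_apply, h0,
    map_zero, add_zero, d_ofZeroForm]
  change hodgeStar q (d q hq (hodgeStar q (ofForm q 1 (extDeriv q hq 0 φ)))) = _
  -- For numerals, `Fin.rev` reduces definitionally: `3` reverses to `1`, and below `0` reverses to
  -- `4`.
  have h1 : ∀ w : Form q 1, hodgeStar q (ofForm q 1 w) = ofForm q 3 (hodge q 1 3 w) :=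
    hodgeStar_ofForm q 3
  have h4 : ∀ w : Form q 4, hodgeStar q (ofForm q 4 w) = ofForm q 0 (hodge q 4 0 w) :=
    hodgeStar_ofForm q 0
  rw [h1, d_ofForm_three, h4]
  rfl

end

end QMinkowski

theorem mainTheorem7 (q : ℝ) (hq : q ≠ 0) (φ : QMinkowski.Form q 0) :
    QMinkowski.laplaceBeltrami q hq (QMinkowski.ofZeroForm q φ) = 0 ↔
      QMinkowski.dAlembert q hq (φ (QMinkowski.e q ![])) = 0 := by
  have hinj : Function.Injective (QMinkowski.ofZeroForm q) :=
    Pi.single_injective (M := fun p : Fin 5 => QMinkowski.Form q p) 0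
  have hk : ∀ p, (((Real.sqrt (QMinkowski.normFactor q p))⁻¹ : ℝ) : ℂ) ≠ 0 := fun p =>
    Complex.ofReal_ne_zero.mpr
      (inv_ne_zero (Real.sqrt_pos.mpr (QMinkowski.normFactor_pos q hq p)).ne')
  rw [QMinkowski.laplaceBeltrami_ofZeroForm, map_eq_zero_iff _ hinj,
    QMinkowski.form_zero_eq_zero_iff, QMinkowski.hodge_extDeriv_hodge_extDeriv_e, smul_eq_zero]
  -- It remains to see that the scalar in front of `□φ` does not vanish.
  refine or_iff_right ?_
  exact mul_ne_zero (mul_ne_zero (mul_ne_zero (neg_ne_zero.mpr (hk 4)) (hk 1))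
    (QMinkowski.normOne_ne_zero q)) (QMinkowski.ofReal_add_inv_ne_zero q hq)
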